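/- **Theorem 1 (identifiability of $w$).** Fix integers $n,k,q,d,m\ge 0$ and a probability measure $\nu$ on $\mathbb R^d$ whose characteristic function is nonzero Lebesgue-almost everywhere ($\nu=\delta_0$, i.e. no output noise, is allowed). *Model.* A model $M=(f,Q,T,\lambda,p_z,\rho)$ consists of a measurable decoder $f:\mathbb R^n\times\mathbb R^q\to\mathbb R^d$, measurable base densities $Q_i:\mathbb R\to[0,\infty)$, measurable sufficient statistics $T_{i,j}:\mathbb R\to\mathbb R$ and measurable natural parameters $\lambda_{i,j}:\mathbb R^m\to\mathbb R$ ($1\le i\le n$, $1\le j\le k$), and probability measures $p_z$ on $\mathbb R^q$ and $\rho$ on $\mathbb R^m$, such that for $\rho$-almost every $y$ all $Z_i(y)=\int Q_i(t)\exp\big(\sum_j T_{i,j}(t)\lambda_{i,j}(y)\big)dt$ are finite and positive. It generates the concepts $y\sim\rho$, the concept latents $w\in\mathbb R^n$ with $$p(w\mid y)=\prod_{i=1}^n \frac{Q_i(w_i)}{Z_i(y)}\exp\Big(\sum_{j=1}^k T_{i,j}(w_i)\lambda_{i,j}(y)\Big),$$ the nuisance latent $z\sim p_z$ independent of $(w,y)$,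 and the observation $x=f(w,z)+\varepsilon$ with $\varepsilon\sim\nu$ independent of $(w,z,y)$. Write $T(w)=(T_{i,j}(w_i))_{i,j}\in\mathbb R^{nk}$ and $\lambda(y)=(\lambda_{i,j}(y))_{i,j}\in\mathbb R^{nk}$. *Assumptions.* Let $M$ and $M'=(f',Q',T',\lambda',p_z',\rho')$ be two such models (with the same $\nu$) such that $f$ and $f'$ are injective and both models give the same joint law $p(x,y)$. Assume that $M$ satisfies: 1. (strongly exponential) for every $i$, every $v\in\mathbb R^k\setminus\{0\}$ and every $b\in\mathbb R$, the set $\{t: Q_i(t)>0,\ \sum_j v_jT_{i,j}(t)=b\}$ is Lebesgue-null; 2. (variability) outside every $\rho$-null set there are points $y^0,\dots,y^{nk}$ such that the $nk\times nk$ matrix with columns $\lambda(y^l)-\lambda(y^0)$, $1\le l\le nk$, is invertible. *Conclusion.* There are an invertible matrix $A\in\mathbb R^{nk\times nk}$ and a vector $c\in\mathbb R^{nk}$ such that: * (a) the noiseless outputs $f(w,z)$ and $f'(w',z')$ have the same law, and for almost every value $s=f(w,z)=f'(w',z')$ under this law, $$T(w)=A\,T'(w')+c;$$ * (b) if moreover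 $f$ and $f'$ are homeomorphisms onto their images, and for both models every set $\{Q_i>0\}$ is open with the $T_{i,j}$ continuous on it, then $T(w)=A\,T'(w')+c$ holds whenever $f(w,z)=f'(w',z')$ and $(w,z)$, $(w',z')$ lie in the latent supports $\{Q_i(w_i)>0\ \forall i\}\times\operatorname{supp}p_z$ of $M$ and the analogous set for $M'$; * (c) if $k\ge 2$ (e.g. mean and variance, $T_i(t)=(t,t^2)$) and for both models every set $\{Q_i>0\}$ is open with the $T_{i,j}$ continuously differentiable on it, then $A$ is a block permutation matrix: there is a permutation $\sigma$ of $\{1,\dots,n\}$ such that the $k\times k$ block of $A$ at $(i,i')$ vanishes unless $i'=\sigma(i)$, so that the statistics of $w_i$ are an invertible affine function of those of $w'_{\sigma(i)}$ alone. Nothing is asserted about the nuisance latent $z$. -/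

import Mathlib

open MeasureTheory Matrix

noncomputable section

/-- Parameters of a conditional latent variable model with concept latents `w ∈ ℝⁿ`, nuisance
latents `z ∈ ℝ^q`, observation `x ∈ ℝ^d` and auxiliary variable (the concepts) `y ∈ ℝ^m`:

* `y ∼ conceptLaw`, and `z ∼ nuisancePrior` independently of `(w, y)`;
* given `y`, the coordinates of `w` are independent, and `w_i` has the exponential family density
  `base i t / Z_i(y) * exp (∑ j, stat i j t * natParam y i j)` with `k` sufficient statistics;
* `x = decoder (w, z) + ε` with `ε` independent of `(w, z, y)`.

The fields after the data only say that this is well defined: everything is measurable and, for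
almost every `y`, the normalizing integrals are finite and positive. -/
structure IVAEModel (n k q d m : ℕ) where
  /-- the decoder (mixing function) `f` -/
  decoder : (Fin n → ℝ) × (Fin q → ℝ) → EuclideanSpace ℝ (Fin d)
  /-- the base density `Q_i` -/
  base : Fin n → ℝ → ℝ
  /-- the sufficient statistics `T_{i,j}` -/
  stat : Fin n → Fin k → ℝ → ℝ
  /-- the natural parameters `λ_{i,j}(y)` -/
  natParam : (Fin m → ℝ) → Fin n → Fin k → ℝ
  /-- the unconditional law of `z` -/
  nuisancePrior : Measure (Fin q → ℝ)
  /-- the law of `y` -/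
  conceptLaw : Measure (Fin m → ℝ)
  measurable_decoder : Measurable decoder
  measurable_base : ∀ i, Measurable (base i)
  base_nonneg : ∀ i t, 0 ≤ base i t
  measurable_stat : ∀ i j, Measurable (stat i j)
  measurable_natParam : ∀ i j, Measurable fun y => natParam y i j
  isProbabilityMeasure_nuisancePrior : IsProbabilityMeasure nuisancePrior
  isProbabilityMeasure_conceptLaw : IsProbabilityMeasure conceptLaw
  integrable_weight : ∀ᵐ y ∂conceptLaw, ∀ i,
    Integrable fun t => base i t * Real.exp (∑ j, stat i j t * natParam y i j)
  normalizer_pos : ∀ᵐ y ∂conceptLaw, ∀ i,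
    0 < ∫ t, base i t * Real.exp (∑ j, stat i j t * natParam y i j)

namespace IVAEModel

variable {n k q d m : ℕ}

/-- The normalizing constant `Z_i(y)`. -/
def normalizer (M : IVAEModel n k q d m) (i : Fin n) (y : Fin m → ℝ) : ℝ :=
  ∫ t, M.base i t * Real.exp (∑ j, M.stat i j t * M.natParam y i j)

/-- The conditional density `p(w_i = t ∣ y)`. -/
def condDensity (M : IVAEModel n k q d m) (i : Fin n) (y : Fin m → ℝ) (t : ℝ) : ℝ :=
  M.base i t * Real.exp (∑ j, M.stat i j t * M.natParam y i j) / M.normalizer i y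

/-- The joint law of `((w, z), y)`: density `∏ i, p(w_i ∣ y)` with respect to
`dw ⊗ p(dz) ⊗ p(dy)`. -/
def latentLaw (M : IVAEModel n k q d m) : Measure (((Fin n → ℝ) × (Fin q → ℝ)) × (Fin m → ℝ)) :=
  (((volume : Measure (Fin n → ℝ)).prod M.nuisancePrior).prod M.conceptLaw).withDensity
    fun p => ∏ i, ENNReal.ofReal (M.condDensity i p.2 (p.1.1 i))

/-- The observational law `p(x, y)`, where `x = decoder (w, z) + ε` and `ε ∼ ν` is independent of
`(w, z, y)`. The noiseless model is `ν = Measure.dirac 0`. -/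
def obsLaw (M : IVAEModel n k q d m) (ν : Measure (EuclideanSpace ℝ (Fin d))) :
    Measure (EuclideanSpace ℝ (Fin d) × (Fin m → ℝ)) :=
  (M.latentLaw.prod ν).map fun r => (M.decoder r.1.1 + r.2, r.1.2)

/-- The law of the noiseless decoder output `decoder (w, z)`. -/
def signalLaw (M : IVAEModel n k q d m) : Measure (EuclideanSpace ℝ (Fin d)) :=
  M.latentLaw.map fun p => M.decoder p.1

/-- The vector `T(w) ∈ ℝ^{nk}` of all sufficient statistics. -/
def statVec (M : IVAEModel n k q d m) (w : Fin n → ℝ) : Fin n × Fin k → ℝ :=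
  fun a => M.stat a.1 a.2 (w a.1)

/-- Each family `(T_{i,1}, …, T_{i,k})` is strongly exponential: no nontrivial linear combination
of its members is constant on a set of positive Lebesgue measure in the support of `w_i`. -/
def StronglyExponential (M : IVAEModel n k q d m) : Prop :=
  ∀ (i : Fin n) (v : Fin k → ℝ) (b : ℝ), v ≠ 0 →
    volume {t : ℝ | 0 < M.base i t ∧ ∑ j, v j * M.stat i j t = b} = 0

/-- The variability condition: there are `nk + 1` values `y⁰, (yˡ)ₗ` of the auxiliary variable for
which the `nk × nk` matrix with columns `λ(yˡ) - λ(y⁰)` is invertible. As the law of `(x, y)`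
determines the conditional law of `x` given `y` only for almost every `y`, such values are asked
for outside every null set of the law of `y`. -/
def Variability (M : IVAEModel n k q d m) : Prop :=
  ∀ N : Set (Fin m → ℝ), M.conceptLaw N = 0 →
    ∃ (y₀ : Fin m → ℝ) (y : Fin n × Fin k → (Fin m → ℝ)), y₀ ∉ N ∧ (∀ l, y l ∉ N) ∧
      IsUnit (Matrix.of fun a l : Fin n × Fin k =>
        M.natParam (y l) a.1 a.2 - M.natParam y₀ a.1 a.2).det

/-- The base densities have open supports `{Q_i > 0}` and the sufficient statistics are `r` times
continuously differentiable there. -/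
def RegularStats (r : ℕ) (M : IVAEModel n k q d m) : Prop :=
  ∀ i, IsOpen {t : ℝ | 0 < M.base i t} ∧
    ∀ j, ContDiffOn ℝ r (M.stat i j) {t : ℝ | 0 < M.base i t}

/-- The support of the latent variables `(w, z)`. -/
def latentSupport (M : IVAEModel n k q d m) : Set ((Fin n → ℝ) × (Fin q → ℝ)) :=
  {p | (∀ i, 0 < M.base i (p.1 i)) ∧ p.2 ∈ M.nuisancePrior.support}

/-- `M` and `M'` produce the same noiseless signal `s`, and for almost every value of `s` the
concept latents `w`, `w'` that the two (injective) decoders assign to `s` are related by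
`T(w) = A T'(w') + c`. -/
def EquivVia (M M' : IVAEModel n k q d m)
    (A : Matrix (Fin n × Fin k) (Fin n × Fin k) ℝ) (c : Fin n × Fin k → ℝ) : Prop :=
  M.signalLaw = M'.signalLaw ∧
    ∀ᵐ s ∂M.signalLaw, ∃ p p', M.decoder p = s ∧ M'.decoder p' = s ∧
      M.statVec p.1 = A *ᵥ M'.statVec p'.1 + c

/-- The same relation between the sufficient statistics at every signal value that both models
reach from their latent supports. -/
def EquivEverywhereVia (M M' : IVAEModel n k q d m)
    (A : Matrix (Fin n × Fin k) (Fin n × Fin k) ℝ) (c : Fin n × Fin k → ℝ) : Prop :=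
  ∀ p ∈ M.latentSupport, ∀ p' ∈ M'.latentSupport, M.decoder p = M'.decoder p' →
    M.statVec p.1 = A *ᵥ M'.statVec p'.1 + c

end IVAEModel

/-- Block permutation pattern: for a permutation `σ` of the coordinates, the `k × k` block of `A`
at `(i, i')` vanishes unless `i' = σ i`. -/
def IsBlockPermutation {n k : ℕ} (A : Matrix (Fin n × Fin k) (Fin n × Fin k) ℝ) : Prop :=
  ∃ σ : Equiv.Perm (Fin n), ∀ i i' j j', i' ≠ σ i → A (i, j) (i', j') = 0

end

/-! The noise is removed first. Restricted to an event of the concepts `y`, the observation law is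
the convolution of the signal law with ν, and dividing characteristic functions where that of ν is
nonzero recovers the joint law of signal and concepts. Uniqueness of disintegrations then gives, for
almost every `y`, the same conditional signal law in both models.

Injective Borel decoders are measurable embeddings, so density ratios of the signal can be read off
on the latents without any Jacobian. The log ratio between `y l` and `y₀` is affine in `T(w)` for
one model and in `T'(w')` for the other. Equating the two for all `nk` values gives a linear system
which variability solves for `T(w)`. This is the relation `Linked` (`exists_linked`).

Strong exponentiality prevents `T(w)` from lying in a hyperplane with positive probability, so `A`
is invertible; the property then passes to the second model. With continuity, a relation valid
almost everywhere holds at every point of the supports.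

For the block structure, `T_i(w_i)` runs along a `C¹` curve. Its projection to two statistics is a
null set of the plane, yet it equals a sum over `i'` of curves in the free variables `w'_{i'}`. If
two of these curves had nonparallel tangents, the sum would cover an open set
(`deriv_mul_deriv_eq_of_ae_add_mem_null`). So if block row `i` had two nonzero blocks, all its
tangents would lie on one line of `ℝ^k`. For `k ≥ 2` this contradicts invertibility. Hence there is
one nonzero block per row, and counting gives a permutation. -/

/-! ### Deconvolution of the noise -/

/-- A finite measure is determined by its convolution with a finite measure whose characteristic
function is almost everywhere nonzero. -/
theorem measure_eq_of_conv_eq {E : Type*} [NormedAddCommGroup E] [InnerProductSpace ℝ E]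
    [MeasurableSpace E] [BorelSpace E] [SecondCountableTopology E] [CompleteSpace E]
    {ρ : Measure E} [ρ.IsOpenPosMeasure]
    {μ μ' ν : Measure E} [IsFiniteMeasure μ] [IsFiniteMeasure μ'] [IsFiniteMeasure ν]
    (hν : ∀ᵐ t ∂ρ, charFun ν t ≠ 0) (h : μ ∗ ν = μ' ∗ ν) : μ = μ' := by
  apply Measure.ext_of_charFun
  -- Characteristic functions are continuous and `ρ` charges every open set, so agreement almost
  -- everywhere suffices.
  refine Continuous.ae_eq_iff_eq ρ continuous_charFun continuous_charFun |>.1 ?_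
  filter_upwards [hν] with t ht
  refine mul_right_cancel₀ ht ?_
  rw [← charFun_conv, ← charFun_conv, h]

/-- Adding independent noise to a signal, restricted to an event of an auxiliary variable, is a
convolution. -/
theorem map_restrict_conv_eq {E α β : Type*} [AddMonoid E] [MeasurableSpace E] [MeasurableAdd₂ E]
    [MeasurableSpace α] [MeasurableSpace β] {μ : Measure β} {ν : Measure E} [IsFiniteMeasure μ]
    [IsProbabilityMeasure ν] {f : β → E} {g : β → α} (hf : Measurable f) (hg : Measurable g)
    {B : Set α} (hB : MeasurableSet B) :
    ((μ.restrict (g ⁻¹' B)).map f) ∗ ν =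
      (((μ.prod ν).map (fun r => (f r.1 + r.2, g r.1))).restrict (Set.univ ×ˢ B)).map
        Prod.fst := by
  have hm : Measurable fun r : β × E => (f r.1 + r.2, g r.1) := by fun_prop
  rw [Measure.restrict_map hm (MeasurableSet.univ.prod hB), Measure.map_map measurable_fst hm,
    Measure.conv]
  have : (fun r : β × E => (f r.1 + r.2, g r.1)) ⁻¹' (Set.univ ×ˢ B)
      = (g ⁻¹' B) ×ˢ (Set.univ : Set E) := by
    ext; simp
  rw [this, ← Measure.prod_restrict, Measure.restrict_univ]
  conv_lhs => rw [← Measure.map_id (μ := ν), Measure.map_prod_map _ _ hf measurable_id,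
    Measure.map_map (by fun_prop) (by fun_prop)]
  rfl

/-- Independent additive noise with almost everywhere nonzero characteristic function does not lose
information on the joint law of a signal and an auxiliary variable. -/
theorem map_prodMk_eq_of_map_add_noise_eq {E α β β' : Type*} [NormedAddCommGroup E]
    [InnerProductSpace ℝ E] [MeasurableSpace E] [BorelSpace E] [SecondCountableTopology E]
    [CompleteSpace E] [MeasurableSpace α] [MeasurableSpace β] [MeasurableSpace β']
    {ρ : Measure E} [ρ.IsOpenPosMeasure]
    {ν : Measure E} [IsProbabilityMeasure ν] (hν : ∀ᵐ t ∂ρ, charFun ν t ≠ 0)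
    {μ : Measure β} {μ' : Measure β'} [IsFiniteMeasure μ] [IsFiniteMeasure μ']
    {f : β → E} {f' : β' → E} {g : β → α} {g' : β' → α} (hf : Measurable f) (hf' : Measurable f')
    (hg : Measurable g) (hg' : Measurable g')
    (h : (μ.prod ν).map (fun r => (f r.1 + r.2, g r.1)) =
      (μ'.prod ν).map (fun r => (f' r.1 + r.2, g' r.1))) :
    μ.map (fun x => (f x, g x)) = μ'.map (fun x => (f' x, g' x)) := by
  apply Measure.ext_prod
  intro s t hs ht
  -- Fixing the event `t` reduces the joint law to a deconvolution of finite measures, one for each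
  -- `t`.
  have h1 : (μ.restrict (g ⁻¹' t)).map f = (μ'.restrict (g' ⁻¹' t)).map f' :=
    measure_eq_of_conv_eq hν (by
      rw [map_restrict_conv_eq hf hg ht, map_restrict_conv_eq hf' hg' ht, h])
  have h2 := congrArg (fun m => m s) h1
  simp only [Measure.map_apply hf hs, Measure.map_apply hf' hs,
    Measure.restrict_apply (hf hs), Measure.restrict_apply (hf' hs)] at h2
  rw [Measure.map_apply (by fun_prop) (hs.prod ht), Measure.map_apply (by fun_prop) (hs.prod ht)]
  exact h2

/-! ### Null sets, translates and plane curves -/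

/-- A measurable set is null if and only if almost all of its translates meet a measurable family
of directions in a null set. -/
theorem ae_notMem_iff_ae_ae_add_notMem {E G : Type*} [AddCommGroup E] [MeasurableSpace E]
    [MeasurableAdd₂ E] [MeasurableSpace G] {μ : Measure E} [SFinite μ]
    [μ.IsAddLeftInvariant] {ρ : Measure G} [SFinite ρ] [NeZero ρ] {φ : G → E}
    (hφ : Measurable φ) {S : Set E} (hS : MeasurableSet S) :
    (∀ᵐ x ∂μ, x ∉ S) ↔ ∀ᵐ x ∂μ, ∀ᵐ g ∂ρ, x + φ g ∉ S := by
  have hm : MeasurableSet {p : E × G | p.1 + φ p.2 ∈ S} :=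
    (measurable_fst.add (hφ.comp measurable_snd)) hS
  have hm' : MeasurableSet {p : G × E | p.2 + φ p.1 ∈ S} :=
    (measurable_snd.add (hφ.comp measurable_fst)) hS
  have e1 : (∀ᵐ x ∂μ, ∀ᵐ g ∂ρ, x + φ g ∉ S) ↔ ∀ᵐ p ∂μ.prod ρ, p.1 + φ p.2 ∉ S :=
    (Measure.ae_prod_iff_ae_ae hm.compl).symm
  have e2 : (∀ᵐ p ∂μ.prod ρ, p.1 + φ p.2 ∉ S) ↔ ∀ᵐ g ∂ρ, ∀ᵐ x ∂μ, x + φ g ∉ S := by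
    rw [← Measure.ae_prod_iff_ae_ae (p := fun p : G × E => p.2 + φ p.1 ∉ S) hm'.compl,
      ← Measure.prod_swap]
    exact ae_map_iff measurable_swap.aemeasurable hm.compl
  have e3 : ∀ g, (∀ᵐ x ∂μ, x + φ g ∉ S) ↔ ∀ᵐ x ∂μ, x ∉ S := by
    intro g
    have h := map_add_left_eq_self μ (φ g)
    conv_rhs => rw [← h, ae_map_iff (measurable_const_add _).aemeasurable hS.compl]
    simp only [add_comm]
  rw [e1, e2]
  -- After Fubini the inner condition no longer depends on `g`, and `ρ ≠ 0` removes the outer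
  -- quantifier.
  simp only [e3, Filter.eventually_const]

/-- A `C¹` curve in the plane is a null set. -/
theorem volume_image_plane_curve_eq_zero {U : Set ℝ} {g h : ℝ → ℝ}
    (hg : ContDiffOn ℝ 1 g U) (hh : ContDiffOn ℝ 1 h U) :
    (volume : Measure (ℝ × ℝ)) ((fun t => (g t, h t)) '' U) = 0 := by
  -- The curve is the image of the null set `U × {0}` under a differentiable map of the plane to
  -- itself.
  have := addHaar_image_eq_zero_of_differentiableOn_of_addHaar_eq_zero
    (E := ℝ × ℝ) (s := U ×ˢ {0}) (f := fun p => (g p.1, h p.1)) volume ?_ ?_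
  · convert this using 2
    ext p; simp
  · have hm : Set.MapsTo (Prod.fst : ℝ × ℝ → ℝ) (U ×ˢ {(0 : ℝ)}) U := fun p hp => hp.1
    exact ((hg.differentiableOn (by simp)).comp differentiableOn_fst hm).prodMk
      ((hh.differentiableOn (by simp)).comp differentiableOn_fst hm)
  · rw [Measure.volume_eq_prod, Measure.prod_prod]; simp

/-- A map of class `C¹` whose derivative at a point is invertible does not send almost all points of
a neighbourhood into a null set. -/
theorem not_ae_mem_null_of_contDiffAt {E : Type*} [NormedAddCommGroup E] [NormedSpace ℝ E]
    [FiniteDimensional ℝ E] [MeasurableSpace E] [BorelSpace E] (μ : Measure E)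
    [μ.IsAddHaarMeasure] {f : E → E} {f' : E ≃L[ℝ] E} {a : E} (hf : ContDiffAt ℝ 1 f a)
    (hf' : HasFDerivAt f (f' : E →L[ℝ] E) a) {N : Set E} (hN : μ N = 0) {V : Set E}
    (hV : V ∈ nhds a) (h : ∀ᵐ x ∂μ, x ∈ V → f x ∈ N) : False := by
  have := FiniteDimensional.complete ℝ E
  let e := hf.toOpenPartialHomeomorph f hf' one_ne_zero
  have he : (e : E → E) = f := hf.toOpenPartialHomeomorph_coe hf' one_ne_zero
  have hinv : ContDiffAt ℝ 1 e.symm (f a) := hf.to_localInverse hf' one_ne_zero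
  obtain ⟨W, hW, hdW⟩ := hinv.contDiffOn (m := 1) le_rfl (by simp)
  have ha : a ∈ e.source := hf.mem_toOpenPartialHomeomorph_source hf' one_ne_zero
  -- The differentiable local inverse pulls `N` back to a null set, which would fill almost all of a
  -- neighbourhood of `a`.
  have h0 : μ (e.symm '' (N ∩ W)) = 0 :=
    addHaar_image_eq_zero_of_differentiableOn_of_addHaar_eq_zero μ
      ((hdW.differentiableOn one_ne_zero).mono (by simp))
      (measure_mono_null Set.inter_subset_left hN)
  have hnb : V ∩ (e.source ∩ f ⁻¹' W) ∈ nhds a :=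
    Filter.inter_mem hV (Filter.inter_mem (e.open_source.mem_nhds ha)
      (hf.continuousAt.preimage_mem_nhds hW))
  have hpos := Measure.measure_pos_of_mem_nhds μ hnb
  refine hpos.ne' (measure_mono_null (t := {x | ¬ (x ∈ V → f x ∈ N)} ∪ e.symm '' (N ∩ W)) ?_
    (measure_union_null h h0))
  intro x hx
  by_cases hxN : f x ∈ N
  · refine Or.inr ⟨f x, ⟨hxN, hx.2.2⟩, ?_⟩
    rw [← he]; exact e.left_inv hx.2.1
  · exact Or.inl (by simpa [hx.1] using hxN)

/-- If the sums of points of two `C¹` plane curves almost surely lie in a null set, then the two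
curves have parallel tangents. -/
theorem deriv_mul_deriv_eq_of_ae_add_mem_null {α₁ α₂ β₁ β₂ : ℝ → ℝ} {a b : ℝ}
    (h₁ : ContDiffAt ℝ 1 α₁ a) (h₂ : ContDiffAt ℝ 1 α₂ a)
    (h₃ : ContDiffAt ℝ 1 β₁ b) (h₄ : ContDiffAt ℝ 1 β₂ b) {N : Set (ℝ × ℝ)}
    (hN : volume N = 0) {V : Set (ℝ × ℝ)} (hV : V ∈ nhds (a, b))
    (h : ∀ᵐ p : ℝ × ℝ, p ∈ V → (α₁ p.1 + β₁ p.2, α₂ p.1 + β₂ p.2) ∈ N) :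
    deriv α₁ a * deriv β₂ b = deriv α₂ a * deriv β₁ b := by
  by_contra hne
  have d₁ := (h₁.differentiableAt one_ne_zero).hasDerivAt
  have d₂ := (h₂.differentiableAt one_ne_zero).hasDerivAt
  have d₃ := (h₃.differentiableAt one_ne_zero).hasDerivAt
  have d₄ := (h₄.differentiableAt one_ne_zero).hasDerivAt
  set p := deriv α₁ a
  set q := deriv α₂ a
  set r := deriv β₁ b
  set s := deriv β₂ b
  -- This is the Jacobian determinant at `(a, b)` of the map that adds the two curves.
  have hne' : p * s - q * r ≠ 0 := sub_ne_zero.2 hne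
  let L : (ℝ × ℝ) →L[ℝ] (ℝ × ℝ) :=
    (p • ContinuousLinearMap.fst ℝ ℝ ℝ + r • ContinuousLinearMap.snd ℝ ℝ ℝ).prod
      (q • ContinuousLinearMap.fst ℝ ℝ ℝ + s • ContinuousLinearMap.snd ℝ ℝ ℝ)
  have hinj : Function.Injective L := by
    rw [injective_iff_map_eq_zero]
    rintro ⟨x, y⟩ hxy
    simp only [L, ContinuousLinearMap.prod_apply, _root_.add_apply,
      _root_.smul_apply, ContinuousLinearMap.coe_fst', ContinuousLinearMap.coe_snd',
      smul_eq_mul, Prod.mk_eq_zero] at hxy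
    obtain ⟨e₁, e₂⟩ := hxy
    have hx : (p * s - q * r) * x = 0 := by linear_combination s * e₁ - r * e₂
    have hy : (p * s - q * r) * y = 0 := by linear_combination p * e₂ - q * e₁
    simp_all
  let e : (ℝ × ℝ) ≃L[ℝ] (ℝ × ℝ) :=
    (LinearEquiv.ofInjectiveEndo (L : (ℝ × ℝ) →ₗ[ℝ] (ℝ × ℝ)) hinj).toContinuousLinearEquiv
  have he : (e : (ℝ × ℝ) →L[ℝ] (ℝ × ℝ)) = L := by ext <;> rfl
  refine not_ae_mem_null_of_contDiffAt (f := fun x : ℝ × ℝ => (α₁ x.1 + β₁ x.2, α₂ x.1 + β₂ x.2))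
    (f' := e) (a := (a, b)) volume ?_ ?_ hN hV h
  · exact ((h₁.comp (a, b) contDiffAt_fst).add (h₃.comp (a, b) contDiffAt_snd)).prodMk
      ((h₂.comp (a, b) contDiffAt_fst).add (h₄.comp (a, b) contDiffAt_snd))
  · rw [he]
    have f1 : HasFDerivAt (Prod.fst : ℝ × ℝ → ℝ) (ContinuousLinearMap.fst ℝ ℝ ℝ) (a, b) :=
      hasFDerivAt_fst
    have f2 : HasFDerivAt (Prod.snd : ℝ × ℝ → ℝ) (ContinuousLinearMap.snd ℝ ℝ ℝ) (a, b) :=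
      hasFDerivAt_snd
    exact ((HasDerivAt.comp_hasFDerivAt (a, b) d₁ f1).add
      (HasDerivAt.comp_hasFDerivAt (a, b) d₃ f2)).prodMk
      ((HasDerivAt.comp_hasFDerivAt (a, b) d₂ f1).add (HasDerivAt.comp_hasFDerivAt (a, b) d₄ f2))

/-! ### Conditional latent laws and disintegration -/

namespace IVAEModel

open ProbabilityTheory

variable {n k q d m : ℕ}

instance (M : IVAEModel n k q d m) : IsProbabilityMeasure M.nuisancePrior :=
  M.isProbabilityMeasure_nuisancePrior

instance (M : IVAEModel n k q d m) : IsProbabilityMeasure M.conceptLaw :=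
  M.isProbabilityMeasure_conceptLaw

/-- The values of the auxiliary variable at which all normalizing integrals are finite and
positive. -/
def IsRegularAt (M : IVAEModel n k q d m) (y : Fin m → ℝ) : Prop :=
  ∀ i, (Integrable fun t => M.base i t * Real.exp (∑ j, M.stat i j t * M.natParam y i j)) ∧
    0 < M.normalizer i y

theorem ae_isRegularAt (M : IVAEModel n k q d m) : ∀ᵐ y ∂M.conceptLaw, M.IsRegularAt y := by
  filter_upwards [M.integrable_weight, M.normalizer_pos] with y h₁ h₂ i
  exact ⟨h₁ i, h₂ i⟩

/-- The set of concept latents at which all base densities are positive. -/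
def conceptSupport (M : IVAEModel n k q d m) : Set (Fin n → ℝ) :=
  {w | ∀ i, 0 < M.base i (w i)}

theorem measurableSet_conceptSupport (M : IVAEModel n k q d m) :
    MeasurableSet M.conceptSupport := by
  simp only [conceptSupport, Set.ofPred_forall]
  exact MeasurableSet.iInter fun i =>
    measurableSet_lt measurable_const ((M.measurable_base i).comp (measurable_pi_apply i))

/-- The unweighted reference measure on the latent space, restricted to the support of `w`. -/
noncomputable def latentRef (M : IVAEModel n k q d m) : Measure ((Fin n → ℝ) × (Fin q → ℝ)) :=
  ((volume : Measure (Fin n → ℝ)).prod M.nuisancePrior).restrict (Prod.fst ⁻¹' M.conceptSupport)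

/-- The density of `(w, z)` given `y`. -/
noncomputable def latentDensity (M : IVAEModel n k q d m) (y : Fin m → ℝ) (p : (Fin n → ℝ) × (Fin q → ℝ)) :
    ENNReal :=
  ∏ i, ENNReal.ofReal (M.condDensity i y (p.1 i))

/-- The law of `(w, z)` given `y`. -/
noncomputable def condLatentLaw (M : IVAEModel n k q d m) (y : Fin m → ℝ) :
    Measure ((Fin n → ℝ) × (Fin q → ℝ)) :=
  ((volume : Measure (Fin n → ℝ)).prod M.nuisancePrior).withDensity (M.latentDensity y)

theorem measurable_weight (M : IVAEModel n k q d m) (i : Fin n) :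
    Measurable fun p : (Fin m → ℝ) × ℝ =>
      M.base i p.2 * Real.exp (∑ j, M.stat i j p.2 * M.natParam p.1 i j) := by
  have h₁ := M.measurable_base i
  have h₂ := M.measurable_stat i
  have h₃ := M.measurable_natParam i
  refine (h₁.comp measurable_snd).mul (Real.measurable_exp.comp ?_)
  exact Finset.measurable_sum _ fun j _ =>
    ((h₂ j).comp measurable_snd).mul ((h₃ j).comp measurable_fst)

theorem measurable_normalizer (M : IVAEModel n k q d m) (i : Fin n) :
    Measurable (M.normalizer i) :=
  ((M.measurable_weight i).stronglyMeasurable.integral_prod_right).measurable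

theorem measurable_condDensity (M : IVAEModel n k q d m) (i : Fin n) :
    Measurable fun p : (Fin m → ℝ) × ℝ => M.condDensity i p.1 p.2 :=
  (M.measurable_weight i).div ((M.measurable_normalizer i).comp measurable_fst)

theorem measurable_latentDensity (M : IVAEModel n k q d m) :
    Measurable (Function.uncurry M.latentDensity) := by
  unfold Function.uncurry latentDensity
  refine Finset.measurable_fun_prod _ fun i _ => Measurable.ennreal_ofReal ?_
  exact (M.measurable_condDensity i).comp (measurable_fst.prodMk
    ((measurable_pi_apply i).comp (measurable_fst.comp measurable_snd)))

theorem normalizer_nonneg (M : IVAEModel n k q d m) (i : Fin n) (y : Fin m → ℝ) :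
    0 ≤ M.normalizer i y :=
  integral_nonneg fun _ => mul_nonneg (M.base_nonneg _ _) (Real.exp_nonneg _)

theorem condDensity_nonneg (M : IVAEModel n k q d m) (i : Fin n) (y : Fin m → ℝ) (t : ℝ) :
    0 ≤ M.condDensity i y t :=
  div_nonneg (mul_nonneg (M.base_nonneg _ _) (Real.exp_nonneg _)) (M.normalizer_nonneg i y)

theorem IsRegularAt.condDensity_pos_iff {M : IVAEModel n k q d m} {y : Fin m → ℝ}
    (hy : M.IsRegularAt y) (i : Fin n) (t : ℝ) : 0 < M.condDensity i y t ↔ 0 < M.base i t := by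
  rw [condDensity, div_pos_iff_of_pos_right (hy i).2, mul_pos_iff_of_pos_right (Real.exp_pos _)]

theorem IsRegularAt.latentDensity_ne_zero_iff {M : IVAEModel n k q d m} {y : Fin m → ℝ}
    (hy : M.IsRegularAt y) (p : (Fin n → ℝ) × (Fin q → ℝ)) :
    M.latentDensity y p ≠ 0 ↔ p ∈ Prod.fst ⁻¹' M.conceptSupport := by
  simp [latentDensity, Finset.prod_ne_zero_iff, conceptSupport, hy.condDensity_pos_iff]

/-- The exponential factor never vanishes, so the null sets of the conditional law do not depend on
`y`. One reference measure thus serves all concepts. -/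
theorem IsRegularAt.ae_condLatentLaw_iff {M : IVAEModel n k q d m} {y : Fin m → ℝ}
    (hy : M.IsRegularAt y) {P : (Fin n → ℝ) × (Fin q → ℝ) → Prop} :
    (∀ᵐ p ∂M.condLatentLaw y, P p) ↔ ∀ᵐ p ∂M.latentRef, P p := by
  rw [condLatentLaw, ae_withDensity_iff (M.measurable_latentDensity.of_uncurry_left), latentRef,
    ae_restrict_iff' (measurable_fst M.measurableSet_conceptSupport)]
  simp only [hy.latentDensity_ne_zero_iff]

theorem IsRegularAt.condLatentLaw_univ {M : IVAEModel n k q d m} {y : Fin m → ℝ}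
    (hy : M.IsRegularAt y) : M.condLatentLaw y Set.univ = 1 := by
  have hint : ∀ i, Integrable (M.condDensity i y) := fun i => (hy i).1.div_const _
  rw [condLatentLaw, withDensity_apply _ MeasurableSet.univ, Measure.restrict_univ]
  have h₁ : ∀ p : (Fin n → ℝ) × (Fin q → ℝ), M.latentDensity y p =
      (fun w : Fin n → ℝ => ENNReal.ofReal (∏ i, M.condDensity i y (w i))) p.1 := fun p =>
    (ENNReal.ofReal_prod_of_nonneg fun i _ => M.condDensity_nonneg i y _).symm
  have hm : Measurable fun w : Fin n → ℝ => ENNReal.ofReal (∏ i, M.condDensity i y (w i)) :=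
    ENNReal.measurable_ofReal.comp <| Finset.measurable_fun_prod _ fun i _ =>
      (M.measurable_condDensity i).comp (measurable_const.prodMk (measurable_pi_apply i))
  rw [lintegral_congr h₁, measurePreserving_fst.lintegral_comp hm,
    ← ofReal_integral_eq_lintegral_ofReal (volume_pi (α := fun _ : Fin n => ℝ) ▸
        Integrable.fintype_prod (μ := fun _ => volume) hint)
      (Filter.Eventually.of_forall fun w => Finset.prod_nonneg fun i _ =>
        M.condDensity_nonneg i y _),
    integral_fintype_prod_volume_eq_prod]
  have : ∀ i, ∫ t, M.condDensity i y t = 1 := fun i => by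
    simp only [condDensity, integral_div]
    exact div_self (hy i).2.ne'
  simp [this]

/-- Needed at every `y` for a finite kernel. If some normalizer is not positive, it is zero, and
division by zero makes the density vanish; a positive one forces integrability, since a divergent
integral is assigned the value zero. -/
theorem condLatentLaw_univ_le_one (M : IVAEModel n k q d m) (y : Fin m → ℝ) :
    M.condLatentLaw y Set.univ ≤ 1 := by
  by_cases hy : ∀ i, 0 < M.normalizer i y
  · refine le_of_eq (IsRegularAt.condLatentLaw_univ fun i => ⟨?_, hy i⟩)
    by_contra hi
    exact (hy i).ne' (integral_undef hi)
  · push Not at hy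
    obtain ⟨i, hi⟩ := hy
    have hi0 : M.normalizer i y = 0 := le_antisymm hi (M.normalizer_nonneg i y)
    have : M.latentDensity y = 0 := by
      funext p
      exact Finset.prod_eq_zero (Finset.mem_univ i) (by simp [condDensity, hi0])
    simp [condLatentLaw, this]

/-- The laws of `(w, z)` given `y`, as a kernel. -/
noncomputable def latentKernel (M : IVAEModel n k q d m) :
    Kernel (Fin m → ℝ) ((Fin n → ℝ) × (Fin q → ℝ)) :=
  (Kernel.const _ ((volume : Measure (Fin n → ℝ)).prod M.nuisancePrior)).withDensity
    M.latentDensity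

theorem latentKernel_apply (M : IVAEModel n k q d m) (y : Fin m → ℝ) :
    M.latentKernel y = M.condLatentLaw y := by
  rw [latentKernel, Kernel.withDensity_apply _ M.measurable_latentDensity, Kernel.const_apply]
  rfl

instance (M : IVAEModel n k q d m) : IsFiniteKernel M.latentKernel :=
  ⟨1, ENNReal.one_lt_top, fun y => by
    rw [latentKernel_apply]; exact M.condLatentLaw_univ_le_one y⟩

theorem map_swap_latentLaw (M : IVAEModel n k q d m) :
    M.latentLaw.map Prod.swap = M.conceptLaw ⊗ₘ M.latentKernel := by
  have : IsSFiniteKernel ((Kernel.const (Fin m → ℝ)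
      ((volume : Measure (Fin n → ℝ)).prod M.nuisancePrior)).withDensity M.latentDensity) :=
    inferInstanceAs (IsSFiniteKernel M.latentKernel)
  rw [latentKernel, Measure.compProd_withDensity M.measurable_latentDensity,
    Measure.compProd_const, ← Measure.prod_swap, latentLaw]
  ext s hs
  rw [Measure.map_apply measurable_swap hs, withDensity_apply _ (measurable_swap hs),
    withDensity_apply _ hs]
  exact (setLIntegral_map hs M.measurable_latentDensity measurable_swap).symm

instance (M : IVAEModel n k q d m) : IsFiniteMeasure M.latentLaw := by
  have : IsFiniteMeasure (M.latentLaw.map Prod.swap) := by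
    rw [M.map_swap_latentLaw]; infer_instance
  exact Measure.isFiniteMeasure_of_map measurable_swap.aemeasurable

theorem map_snd_latentLaw (M : IVAEModel n k q d m) :
    M.latentLaw.map Prod.snd = M.conceptLaw := by
  have : M.latentLaw.map Prod.snd = (M.latentLaw.map Prod.swap).map Prod.fst := by
    rw [Measure.map_map measurable_fst measurable_swap]; rfl
  rw [this, M.map_swap_latentLaw]
  ext s hs
  rw [Measure.map_apply measurable_fst hs, Measure.compProd_apply (measurable_fst hs),
    ← lintegral_indicator_one hs]
  refine lintegral_congr_ae ?_
  filter_upwards [M.ae_isRegularAt] with y hy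
  rw [latentKernel_apply]
  by_cases h : y ∈ s
  · have : Prod.mk y ⁻¹' (Prod.fst ⁻¹' s) = (Set.univ : Set ((Fin n → ℝ) × (Fin q → ℝ))) := by
      ext; simp [h]
    simp [this, h, hy.condLatentLaw_univ]
  · have : Prod.mk y ⁻¹' (Prod.fst ⁻¹' s) = (∅ : Set ((Fin n → ℝ) × (Fin q → ℝ))) := by
      ext; simp [h]
    simp [this, h]

/-- The joint law of the noiseless signal and the auxiliary variable. -/
noncomputable def jointLaw (M : IVAEModel n k q d m) : Measure (EuclideanSpace ℝ (Fin d) × (Fin m → ℝ)) :=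
  M.latentLaw.map fun p => (M.decoder p.1, p.2)

theorem jointLaw_eq_of_obsLaw_eq {ν : Measure (EuclideanSpace ℝ (Fin d))} [IsProbabilityMeasure ν]
    (hν : ∀ᵐ t ∂(volume : Measure (EuclideanSpace ℝ (Fin d))), charFun ν t ≠ 0)
    {M M' : IVAEModel n k q d m} (hobs : M.obsLaw ν = M'.obsLaw ν) :
    M.jointLaw = M'.jointLaw :=
  map_prodMk_eq_of_map_add_noise_eq hν (M.measurable_decoder.comp measurable_fst)
    (M'.measurable_decoder.comp measurable_fst) measurable_snd measurable_snd hobs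

theorem measurable_decoder_prodMk (M : IVAEModel n k q d m) :
    Measurable fun p : ((Fin n → ℝ) × (Fin q → ℝ)) × (Fin m → ℝ) => (M.decoder p.1, p.2) :=
  (M.measurable_decoder.comp measurable_fst).prodMk measurable_snd

theorem map_fst_jointLaw (M : IVAEModel n k q d m) : M.jointLaw.map Prod.fst = M.signalLaw := by
  rw [jointLaw, Measure.map_map measurable_fst M.measurable_decoder_prodMk]; rfl

theorem map_snd_jointLaw (M : IVAEModel n k q d m) : M.jointLaw.map Prod.snd = M.conceptLaw := by
  rw [jointLaw, Measure.map_map measurable_snd M.measurable_decoder_prodMk,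
    ← M.map_snd_latentLaw]; rfl

theorem map_swap_jointLaw (M : IVAEModel n k q d m) :
    M.jointLaw.map Prod.swap = M.conceptLaw ⊗ₘ M.latentKernel.map M.decoder := by
  rw [Measure.compProd_map M.measurable_decoder, ← map_swap_latentLaw, jointLaw,
    Measure.map_map measurable_swap M.measurable_decoder_prodMk,
    Measure.map_map (measurable_id.prodMap M.measurable_decoder) measurable_swap]
  rfl

/-- Both kernels disintegrate the same joint law over the same marginal, and such a kernel is unique
almost everywhere. -/
theorem ae_map_condLatentLaw_eq {M M' : IVAEModel n k q d m} (h : M.jointLaw = M'.jointLaw) :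
    ∀ᵐ y ∂M.conceptLaw,
      (M.condLatentLaw y).map M.decoder = (M'.condLatentLaw y).map M'.decoder := by
  have hc : M'.conceptLaw = M.conceptLaw := by
    rw [← map_snd_jointLaw, ← map_snd_jointLaw, h]
  have hk : M.conceptLaw ⊗ₘ M.latentKernel.map M.decoder =
      M.conceptLaw ⊗ₘ M'.latentKernel.map M'.decoder := by
    rw [← map_swap_jointLaw, h, map_swap_jointLaw, hc]
  filter_upwards [Kernel.ae_eq_of_compProd_eq hk] with y hy
  rwa [Kernel.map_apply _ M.measurable_decoder, Kernel.map_apply _ M'.measurable_decoder,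
    latentKernel_apply, latentKernel_apply] at hy

theorem ae_signalLaw_of_ae_latentRef {M : IVAEModel n k q d m}
    (hf : MeasurableEmbedding M.decoder) {P : EuclideanSpace ℝ (Fin d) → Prop}
    (h : ∀ᵐ p ∂M.latentRef, P (M.decoder p)) : ∀ᵐ s ∂M.signalLaw, P s := by
  have e : M.signalLaw = (M.latentLaw.map Prod.fst).map M.decoder := by
    rw [Measure.map_map M.measurable_decoder measurable_fst]; rfl
  rw [e, hf.ae_map_iff]
  have hm : M.latentLaw.map Prod.fst = (M.latentLaw.map Prod.swap).map Prod.snd := by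
    rw [Measure.map_map measurable_snd measurable_swap]; rfl
  rw [hm, map_swap_latentLaw]
  have h0 : M.latentRef {p | ¬ P (M.decoder p)} = 0 := h
  -- `P` need not be measurable, so the exceptional set is enlarged to a measurable null set before
  -- integrating over `y`.
  refine measure_mono_null (t := toMeasurable M.latentRef {p | ¬ P (M.decoder p)})
    (subset_toMeasurable _ _) ?_
  rw [Measure.map_apply measurable_snd (measurableSet_toMeasurable _ _),
    Measure.compProd_apply (measurable_snd (measurableSet_toMeasurable _ _)), lintegral_eq_zero_iff
      (Kernel.measurable_kernel_prodMk_left (measurable_snd (measurableSet_toMeasurable _ _)))]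
  filter_upwards [M.ae_isRegularAt] with y hy
  have : M.latentRef (toMeasurable M.latentRef {p | ¬ P (M.decoder p)}) = 0 := by
    rw [measure_toMeasurable, h0]
  have h2 : ∀ᵐ p ∂M.latentRef, p ∉ toMeasurable M.latentRef {p | ¬ P (M.decoder p)} :=
    measure_eq_zero_iff_ae_notMem.1 this
  rw [← hy.ae_condLatentLaw_iff, ← measure_eq_zero_iff_ae_notMem] at h2
  rw [latentKernel_apply]
  exact h2

/-! ### Density ratios and the affine relation -/

/-- The logarithm of the ratio of the densities of `w` given `y` and given `y₀`. -/
noncomputable def logRatio (M : IVAEModel n k q d m) (y₀ y : Fin m → ℝ) (w : Fin n → ℝ) : ℝ :=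
  ∑ a : Fin n × Fin k, (M.natParam y a.1 a.2 - M.natParam y₀ a.1 a.2) * M.statVec w a +
    ∑ i, (Real.log (M.normalizer i y₀) - Real.log (M.normalizer i y))

theorem measurable_logRatio (M : IVAEModel n k q d m) (y₀ y : Fin m → ℝ) :
    Measurable (M.logRatio y₀ y) := by
  have h := M.measurable_stat
  unfold logRatio statVec
  refine Measurable.add ?_ measurable_const
  exact Finset.measurable_fun_sum _ fun a _ =>
    ((h a.1 a.2).comp (measurable_pi_apply a.1)).const_mul _

theorem prod_condDensity_eq {M : IVAEModel n k q d m} {y₀ y : Fin m → ℝ}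
    (h₀ : M.IsRegularAt y₀) (h : M.IsRegularAt y) (w : Fin n → ℝ) :
    ∏ i, M.condDensity i y (w i) =
      (∏ i, M.condDensity i y₀ (w i)) * Real.exp (M.logRatio y₀ y w) := by
  rw [logRatio, Fintype.sum_prod_type, ← Finset.sum_add_distrib, Real.exp_sum,
    ← Finset.prod_mul_distrib]
  refine Finset.prod_congr rfl fun i _ => ?_
  have e : ∀ y', M.IsRegularAt y' → M.condDensity i y' (w i) = M.base i (w i) *
      Real.exp ((∑ j, M.stat i j (w i) * M.natParam y' i j) - Real.log (M.normalizer i y')) := by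
    intro y' hy'
    rw [condDensity, Real.exp_sub, Real.exp_log (hy' i).2, mul_div_assoc]
  rw [e y h, e y₀ h₀, mul_assoc, ← Real.exp_add]
  congr 2
  simp only [statVec, sub_mul, Finset.sum_sub_distrib, mul_comm (M.natParam _ _ _)]
  ring

theorem condLatentLaw_eq_withDensity {M : IVAEModel n k q d m} {y₀ y : Fin m → ℝ}
    (h₀ : M.IsRegularAt y₀) (h : M.IsRegularAt y) :
    M.condLatentLaw y = (M.condLatentLaw y₀).withDensity
      fun p => ENNReal.ofReal (Real.exp (M.logRatio y₀ y p.1)) := by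
  have hm : Measurable fun p : (Fin n → ℝ) × (Fin q → ℝ) =>
      ENNReal.ofReal (Real.exp (M.logRatio y₀ y p.1)) :=
    ((M.measurable_logRatio y₀ y).comp measurable_fst).exp.ennreal_ofReal
  rw [condLatentLaw, condLatentLaw,
    ← withDensity_mul _ M.measurable_latentDensity.of_uncurry_left hm]
  congr 1
  funext p
  simp only [latentDensity, Pi.mul_apply]
  rw [← ENNReal.ofReal_prod_of_nonneg fun i _ => M.condDensity_nonneg i y _,
    ← ENNReal.ofReal_prod_of_nonneg fun i _ => M.condDensity_nonneg i y₀ _,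
    ← ENNReal.ofReal_mul (Finset.prod_nonneg fun i _ => M.condDensity_nonneg i y₀ _),
    prod_condDensity_eq h₀ h]

theorem _root_.MeasurableEmbedding.map_withDensity_eq {α γ : Type*} [MeasurableSpace α]
    [MeasurableSpace γ] {f : α → γ} (hf : MeasurableEmbedding f) {μ : Measure α}
    {u : α → ENNReal} :
    (μ.withDensity u).map f = (μ.map f).withDensity (Function.extend f u 0) := by
  ext s hs
  rw [hf.map_apply, withDensity_apply _ (hf.measurable hs), withDensity_apply _ hs,
    hf.restrict_map, hf.lintegral_map]
  simp [hf.injective.extend_apply]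

/-- Equal pushforwards of densities with respect to measures with equal pushforwards are equal
almost everywhere. -/
theorem ae_density_eq_of_map_eq {α β γ : Type*} [MeasurableSpace α] [MeasurableSpace β]
    [MeasurableSpace γ] {f : α → γ} {g : β → γ} (hf : MeasurableEmbedding f)
    (hg : MeasurableEmbedding g) {μ : Measure α} {ρ : Measure β} [IsFiniteMeasure μ]
    {u : α → ENNReal} {v : β → ENNReal} (hu : Measurable u) (hv : Measurable v)
    (h₀ : μ.map f = ρ.map g) (h : (μ.withDensity u).map f = (ρ.withDensity v).map g) :
    ∀ᵐ x ∂μ, ∀ x', g x' = f x → u x = v x' := by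
  rw [hf.map_withDensity_eq, hg.map_withDensity_eq, ← h₀, withDensity_eq_iff_of_sigmaFinite
    (hf.measurable_extend hu measurable_zero).aemeasurable
    (hg.measurable_extend hv measurable_zero).aemeasurable, Filter.EventuallyEq,
    hf.ae_map_iff] at h
  filter_upwards [h] with x hx x' hx'
  rwa [hf.injective.extend_apply, ← hx', hg.injective.extend_apply] at hx

instance (M : IVAEModel n k q d m) (y : Fin m → ℝ) : IsFiniteMeasure (M.condLatentLaw y) :=
  ⟨(M.condLatentLaw_univ_le_one y).trans_lt ENNReal.one_lt_top⟩

/-- Two models are linked by `(A, c)` if their signals have the same null sets and at almost every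
common signal value the sufficient statistics are related by the affine map `(A, c)`. -/
structure Linked (M M' : IVAEModel n k q d m)
    (A : Matrix (Fin n × Fin k) (Fin n × Fin k) ℝ) (c : Fin n × Fin k → ℝ) : Prop where
  transfer : ∀ P : EuclideanSpace ℝ (Fin d) → Prop,
    (∀ᵐ p ∂M.latentRef, P (M.decoder p)) ↔ ∀ᵐ p ∂M'.latentRef, P (M'.decoder p)
  statVec_eq : ∀ᵐ p ∂M.latentRef, ∀ p', M'.decoder p' = M.decoder p →
    M.statVec p.1 = A *ᵥ M'.statVec p'.1 + c

theorem ae_mem_conceptSupport (M : IVAEModel n k q d m) :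
    ∀ᵐ p ∂M.latentRef, p.1 ∈ M.conceptSupport :=
  ae_restrict_mem (measurable_fst M.measurableSet_conceptSupport)

theorem Linked.exists_left {M M' : IVAEModel n k q d m}
    {A : Matrix (Fin n × Fin k) (Fin n × Fin k) ℝ} {c : Fin n × Fin k → ℝ}
    (h : M.Linked M' A c) : ∀ᵐ p ∂M.latentRef, ∃ p', p'.1 ∈ M'.conceptSupport ∧
      M'.decoder p' = M.decoder p ∧ M.statVec p.1 = A *ᵥ M'.statVec p'.1 + c := by
  have h₁ := (h.transfer fun s => ∃ p', p'.1 ∈ M'.conceptSupport ∧ M'.decoder p' = s).2 (by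
    filter_upwards [M'.ae_mem_conceptSupport] with p hp using ⟨p, hp, rfl⟩)
  filter_upwards [h₁, h.statVec_eq] with p ⟨p', hp', e⟩ h₂
  exact ⟨p', hp', e, h₂ p' e⟩

/-- The existence of a matched pair is a property of the signal alone, so `transfer` moves it to the
second model; injectivity identifies the latent found there with the given one. -/
theorem Linked.exists_right {M M' : IVAEModel n k q d m}
    {A : Matrix (Fin n × Fin k) (Fin n × Fin k) ℝ} {c : Fin n × Fin k → ℝ}
    (hf' : Function.Injective M'.decoder)
    (h : M.Linked M' A c) : ∀ᵐ p' ∂M'.latentRef, ∃ p, p.1 ∈ M.conceptSupport ∧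
      M.decoder p = M'.decoder p' ∧ M.statVec p.1 = A *ᵥ M'.statVec p'.1 + c := by
  have := (h.transfer fun s => ∃ p p', p.1 ∈ M.conceptSupport ∧ M.decoder p = s ∧
    M'.decoder p' = s ∧ M.statVec p.1 = A *ᵥ M'.statVec p'.1 + c).1 (by
      filter_upwards [h.exists_left, M.ae_mem_conceptSupport] with p ⟨p', _, e, e'⟩ hp
      exact ⟨p, p', hp, rfl, e, e'⟩)
  filter_upwards [this] with p' ⟨p, p'', hp, e₁, e₂, e₃⟩
  obtain rfl := hf' e₂
  exact ⟨p, hp, e₁, e₃⟩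

theorem measurableEmbedding_decoder {M : IVAEModel n k q d m}
    (hf : Function.Injective M.decoder) : MeasurableEmbedding M.decoder :=
  M.measurable_decoder.measurableEmbedding hf

theorem exists_linked {M M' : IVAEModel n k q d m} (hf : Function.Injective M.decoder)
    (hf' : Function.Injective M'.decoder) (hL : M.Variability) (hJ : M.jointLaw = M'.jointLaw) :
    ∃ A c, M.Linked M' A c := by
  have hc : M'.conceptLaw = M.conceptLaw := by
    rw [← map_snd_jointLaw, ← map_snd_jointLaw, hJ]
  have hgood : ∀ᵐ y ∂M.conceptLaw, M.IsRegularAt y ∧ M'.IsRegularAt y ∧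
      (M.condLatentLaw y).map M.decoder = (M'.condLatentLaw y).map M'.decoder := by
    filter_upwards [M.ae_isRegularAt, hc ▸ M'.ae_isRegularAt, ae_map_condLatentLaw_eq hJ]
      with y h₁ h₂ h₃ using ⟨h₁, h₂, h₃⟩
  -- Variability is applied off the null set where regularity or equality of the conditional laws
  -- fails.
  obtain ⟨y₀, y, h₀, hy, hΛ⟩ := hL _ hgood
  simp only [Set.mem_compl_iff, Set.mem_ofPred_eq, not_not] at h₀ hy
  have ef := measurableEmbedding_decoder hf
  have ef' := measurableEmbedding_decoder hf'
  have hl : ∀ᵐ p ∂M.latentRef, ∀ l, ∀ p', M'.decoder p' = M.decoder p →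
      M.logRatio y₀ (y l) p.1 = M'.logRatio y₀ (y l) p'.1 := by
    rw [ae_all_iff]
    intro l
    rw [← h₀.1.ae_condLatentLaw_iff]
    have := ae_density_eq_of_map_eq ef ef' (μ := M.condLatentLaw y₀) (ρ := M'.condLatentLaw y₀)
      (u := fun p => ENNReal.ofReal (Real.exp (M.logRatio y₀ (y l) p.1)))
      (v := fun p => ENNReal.ofReal (Real.exp (M'.logRatio y₀ (y l) p.1)))
      ((M.measurable_logRatio y₀ _).comp measurable_fst).exp.ennreal_ofReal
      ((M'.measurable_logRatio y₀ _).comp measurable_fst).exp.ennreal_ofReal h₀.2.2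
      (by rw [← condLatentLaw_eq_withDensity h₀.1 (hy l).1,
            ← condLatentLaw_eq_withDensity h₀.2.1 (hy l).2.1, (hy l).2.2])
    filter_upwards [this] with p hp p' e
    have := hp p' e
    rwa [ENNReal.ofReal_eq_ofReal_iff (Real.exp_nonneg _) (Real.exp_nonneg _),
      Real.exp_eq_exp] at this
  let Λ : IVAEModel n k q d m → Matrix (Fin n × Fin k) (Fin n × Fin k) ℝ := fun M =>
    Matrix.of fun l a => M.natParam (y l) a.1 a.2 - M.natParam y₀ a.1 a.2
  let e : IVAEModel n k q d m → Fin n × Fin k → ℝ := fun M l =>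
    ∑ i, (Real.log (M.normalizer i y₀) - Real.log (M.normalizer i (y l)))
  have hΛ' : IsUnit (Λ M).det := by
    rw [← Matrix.det_transpose]; exact hΛ
  -- Solution of `Λ T + e = Λ' T' + e'` for `T`; only the matrix of `M` has to be invertible.
  refine ⟨(Λ M)⁻¹ * Λ M', (Λ M)⁻¹ *ᵥ (e M' - e M), ⟨fun P => ?_, ?_⟩⟩
  · rw [← h₀.1.ae_condLatentLaw_iff, ← h₀.2.1.ae_condLatentLaw_iff, ← ef.ae_map_iff,
      ← ef'.ae_map_iff, h₀.2.2]
  · filter_upwards [hl] with p hp p' hpp'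
    have h₁ : Λ M *ᵥ M.statVec p.1 + e M = Λ M' *ᵥ M'.statVec p'.1 + e M' :=
      funext fun l => hp l p' hpp'
    have h₂ : Λ M *ᵥ M.statVec p.1 = Λ M' *ᵥ M'.statVec p'.1 + (e M' - e M) := by
      rw [eq_sub_of_add_eq h₁]; abel
    rw [← Matrix.mulVec_mulVec, ← Matrix.mulVec_add, ← h₂, Matrix.mulVec_mulVec,
      Matrix.nonsing_inv_mul _ hΛ', Matrix.one_mulVec]

/-! ### Strong exponentiality and invertibility -/

theorem ae_latentRef_fst_iff {M : IVAEModel n k q d m} {P : (Fin n → ℝ) → Prop} :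
    (∀ᵐ p ∂M.latentRef, P p.1) ↔ ∀ᵐ w, w ∈ M.conceptSupport → P w := by
  rw [latentRef, ae_restrict_iff' (measurable_fst M.measurableSet_conceptSupport)]
  constructor
  · intro h
    filter_upwards [Measure.ae_ae_of_ae_prod h] with w hw
    simpa using hw
  · intro h
    exact Measure.quasiMeasurePreserving_fst.ae h

theorem volume_base_pos (M : IVAEModel n k q d m) (i : Fin n) :
    0 < volume {t | 0 < M.base i t} := by
  obtain ⟨y, hy⟩ := M.ae_isRegularAt.exists
  refine pos_iff_ne_zero.2 fun h0 => (hy i).2.ne' ?_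
  have h0' : ∀ᵐ t, ¬ 0 < M.base i t := measure_eq_zero_iff_ae_notMem.1 h0
  refine integral_eq_zero_of_ae ?_
  filter_upwards [h0'] with t ht
  simp [le_antisymm (not_lt.1 ht) (M.base_nonneg i t)]

theorem volume_conceptSupport_inter_pos (M : IVAEModel n k q d m) (i : Fin n) {B : Set ℝ}
    (hB : 0 < volume ({t | 0 < M.base i t} ∩ B)) :
    0 < volume (M.conceptSupport ∩ {w | w i ∈ B}) := by
  classical
  have : M.conceptSupport ∩ {w | w i ∈ B} = Set.univ.pi fun j =>
      if j = i then {t | 0 < M.base i t} ∩ B else {t | 0 < M.base j t} := by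
    ext w
    simp only [Set.mem_inter_iff, conceptSupport, Set.mem_ofPred_eq, Set.mem_univ_pi]
    constructor
    · rintro ⟨h, h'⟩ j
      split_ifs with e
      · subst e; exact ⟨h j, h'⟩
      · exact h j
    · intro h
      have hi := h i
      rw [if_pos rfl] at hi
      refine ⟨fun j => ?_, hi.2⟩
      have hj := h j
      split_ifs at hj with e
      · subst e; exact hj.1
      · exact hj
  rw [this, volume_pi_pi, pos_iff_ne_zero, Finset.prod_ne_zero_iff]
  intro j _
  split_ifs
  · exact hB.ne'
  · exact (M.volume_base_pos j).ne'

theorem volume_conceptSupport_pos (M : IVAEModel n k q d m) : 0 < volume M.conceptSupport := by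
  have : M.conceptSupport = Set.univ.pi fun j => {t | 0 < M.base j t} := by
    ext w; simp [conceptSupport]
  rw [this, volume_pi_pi, pos_iff_ne_zero, Finset.prod_ne_zero_iff]
  exact fun j _ => (M.volume_base_pos j).ne'

theorem measurable_statVec (M : IVAEModel n k q d m) : Measurable M.statVec :=
  measurable_pi_lambda _ fun a => (M.measurable_stat a.1 a.2).comp (measurable_pi_apply a.1)

/-- No nontrivial linear combination of all sufficient statistics is constant on a set of positive
measure in the support of `w`. -/
theorem StronglyExponential.ae_dotProduct_statVec_ne {M : IVAEModel n k q d m}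
    (hT : M.StronglyExponential) {u : Fin n × Fin k → ℝ} (hu : u ≠ 0) (b : ℝ) :
    ∀ᵐ w, w ∈ M.conceptSupport → u ⬝ᵥ M.statVec w ≠ b := by
  classical
  obtain ⟨⟨i, j⟩, hij⟩ := Function.ne_iff.1 hu
  have hS : MeasurableSet {w | w ∈ M.conceptSupport ∧ u ⬝ᵥ M.statVec w = b} := by
    refine M.measurableSet_conceptSupport.inter
      (measurableSet_eq_fun ?_ measurable_const)
    exact Finset.measurable_fun_sum _ fun a _ =>
      ((measurable_pi_apply a).comp M.measurable_statVec).const_mul _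
  suffices ∀ᵐ w, w ∉ {w | w ∈ M.conceptSupport ∧ u ⬝ᵥ M.statVec w = b} by
    filter_upwards [this] with w hw h₁ h₂ using hw ⟨h₁, h₂⟩
  have hφ : Measurable fun t : ℝ => (Pi.single i t : Fin n → ℝ) := measurable_pi_lambda _
    fun l => by
      by_cases h : l = i
      · subst h; simp only [Pi.single_eq_same]; exact measurable_id
      · simp [h]
  -- Only the coordinate `i` is moved; the other coordinates contribute a constant, absorbed into
  -- `b'`.
  rw [ae_notMem_iff_ae_ae_add_notMem (ρ := (volume : Measure ℝ)) hφ hS]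
  refine Filter.Eventually.of_forall fun w => ?_
  set b' := b - ∑ i' ∈ Finset.univ.erase i, ∑ j, u (i', j) * M.stat i' j (w i')
  have h0 := hT i (fun j => u (i, j)) b' (fun h => hij (congrFun h j))
  have h1 : ∀ᵐ t : ℝ, ¬ (0 < M.base i t ∧ ∑ j, u (i, j) * M.stat i j t = b') :=
    measure_eq_zero_iff_ae_notMem.1 h0
  have h2 := (measurePreserving_add_left volume (w i)).quasiMeasurePreserving.ae h1
  filter_upwards [h2] with t ht
  rintro ⟨hs, he⟩
  refine ht ⟨by simpa using hs i, ?_⟩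
  rw [eq_sub_iff_add_eq, ← he, dotProduct, Fintype.sum_prod_type,
    ← Finset.add_sum_erase _ _ (Finset.mem_univ i)]
  congr 1
  · simp [statVec]
  · refine Finset.sum_congr rfl fun i' hi' => ?_
    simp [statVec, Finset.ne_of_mem_erase hi']

/-- A left null vector `u` of `A` would make `u ⬝ᵥ T(w)` constant almost everywhere on a support of
positive measure. -/
theorem Linked.isUnit_det {M M' : IVAEModel n k q d m}
    {A : Matrix (Fin n × Fin k) (Fin n × Fin k) ℝ} {c : Fin n × Fin k → ℝ}
    (h : M.Linked M' A c) (hT : M.StronglyExponential) : IsUnit A.det := by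
  rw [isUnit_iff_ne_zero]
  intro h0
  obtain ⟨u, hu, huA⟩ := Matrix.exists_vecMul_eq_zero_iff.2 h0
  have h₁ : ∀ᵐ p ∂M.latentRef, u ⬝ᵥ M.statVec p.1 = u ⬝ᵥ c := by
    filter_upwards [h.exists_left] with p ⟨p', _, _, e⟩
    rw [e, dotProduct_add, dotProduct_mulVec, huA, zero_dotProduct, zero_add]
  rw [ae_latentRef_fst_iff (P := fun w => u ⬝ᵥ M.statVec w = u ⬝ᵥ c)] at h₁
  refine M.volume_conceptSupport_pos.ne' (measure_eq_zero_iff_ae_notMem.2 ?_)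
  filter_upwards [h₁, hT.ae_dotProduct_statVec_ne hu (u ⬝ᵥ c)] with w h₂ h₃ hw
  exact h₃ hw (h₂ hw)

/-- Since `T' = A⁻¹ (T - c)`, a functional `u` of `T'` is the functional `u A⁻¹` of `T` up to a
constant, and this is nonzero when `u` is. -/
theorem Linked.stronglyExponential {M M' : IVAEModel n k q d m}
    {A : Matrix (Fin n × Fin k) (Fin n × Fin k) ℝ} {c : Fin n × Fin k → ℝ}
    (h : M.Linked M' A c) (hT : M.StronglyExponential) : M'.StronglyExponential := by
  classical
  intro i v b hv
  by_contra hpos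
  let u : Fin n × Fin k → ℝ := fun a => if a.1 = i then v a.2 else 0
  have huT : ∀ w, u ⬝ᵥ M'.statVec w = ∑ j, v j * M'.stat i j (w i) := by
    intro w
    rw [dotProduct, Fintype.sum_prod_type, Finset.sum_eq_single i]
    · simp [u, statVec]
    · intro i' _ hi'; simp [u, hi']
    · simp
  have hA := h.isUnit_det hT
  have hAu : A⁻¹.vecMul u ≠ 0 := by
    intro h0
    have hu : u = 0 := by
      rw [← Matrix.vecMul_one u, ← Matrix.nonsing_inv_mul A hA, ← Matrix.vecMul_vecMul, h0,
        Matrix.zero_vecMul]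
    exact hv (funext fun j => by simpa [u] using congrFun hu (i, j))
  have h₁ := ae_latentRef_fst_iff.2 (hT.ae_dotProduct_statVec_ne hAu (b + (u ᵥ* A⁻¹) ⬝ᵥ c))
  have h₂ := (h.transfer fun s => ∀ p', M'.decoder p' = s → u ⬝ᵥ M'.statVec p'.1 ≠ b).1 (by
    filter_upwards [h₁, h.statVec_eq] with p hp hp' p' e hb
    refine hp ?_
    rw [hp' p' e, dotProduct_add, dotProduct_mulVec, Matrix.vecMul_vecMul,
      Matrix.nonsing_inv_mul A hA, Matrix.vecMul_one, hb])
  have h₃ := (ae_latentRef_fst_iff (P := fun w => u ⬝ᵥ M'.statVec w ≠ b)).1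
    (h₂.mono fun p' hp' => hp' p' rfl)
  refine (M'.volume_conceptSupport_inter_pos i (pos_iff_ne_zero.2 hpos)).ne'
    (measure_eq_zero_iff_ae_notMem.2 ?_)
  filter_upwards [h₃] with w hw hw'
  exact hw hw'.1 (by rw [huT]; exact hw'.2)

/-! ### From almost every signal to every signal -/

theorem Linked.equivVia {M M' : IVAEModel n k q d m}
    {A : Matrix (Fin n × Fin k) (Fin n × Fin k) ℝ} {c : Fin n × Fin k → ℝ}
    (h : M.Linked M' A c) (hf : Function.Injective M.decoder) (hJ : M.jointLaw = M'.jointLaw) :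
    M.EquivVia M' A c := by
  refine ⟨by rw [← map_fst_jointLaw, ← map_fst_jointLaw, hJ],
    ae_signalLaw_of_ae_latentRef (measurableEmbedding_decoder hf) ?_⟩
  filter_upwards [h.exists_left] with p ⟨p', _, e, e'⟩
  exact ⟨p, p', rfl, e, e'⟩

theorem RegularStats.isOpen_conceptSupport {M : IVAEModel n k q d m} {r : ℕ}
    (h : M.RegularStats r) : IsOpen M.conceptSupport := by
  have : M.conceptSupport = Set.univ.pi fun j => {t | 0 < M.base j t} := by
    ext w; simp [conceptSupport]
  rw [this]
  exact isOpen_set_pi Set.finite_univ fun i _ => (h i).1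

theorem RegularStats.continuousAt_statVec {M : IVAEModel n k q d m} {r : ℕ}
    (h : M.RegularStats r) {w : Fin n → ℝ} (hw : w ∈ M.conceptSupport) :
    ContinuousAt M.statVec w := by
  refine continuousAt_pi.2 fun a => ?_
  have := ((h a.1).2 a.2).continuousOn.continuousAt ((h a.1).1.mem_nhds (hw a.1))
  exact ContinuousAt.comp (f := fun w : Fin n → ℝ => w a.1) this (continuous_apply _).continuousAt

theorem RegularStats.mem_support_latentRef {M : IVAEModel n k q d m} {r : ℕ}
    (h : M.RegularStats r) {p : (Fin n → ℝ) × (Fin q → ℝ)} (hp : p ∈ M.latentSupport) :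
    p ∈ M.latentRef.support := by
  rw [Measure.mem_support_iff_forall]
  intro V hV
  have hU : Prod.fst ⁻¹' M.conceptSupport ∈ nhds p :=
    (h.isOpen_conceptSupport.preimage continuous_fst).mem_nhds hp.1
  rw [latentRef, Measure.restrict_apply' (measurable_fst M.measurableSet_conceptSupport)]
  obtain ⟨a, ha, b, hb, hab⟩ := mem_nhds_prod_iff.1 (Filter.inter_mem hV hU)
  refine lt_of_lt_of_le ?_ (measure_mono hab)
  rw [Measure.prod_prod]
  exact ENNReal.mul_pos (Measure.measure_pos_of_mem_nhds _ ha).ne'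
    ((Measure.mem_support_iff_forall _).1 hp.2 b hb).ne'

/-- If the relation failed at one signal, both sides would stay in disjoint open sets for all nearby
signals. These have positive probability, contradicting the relation almost everywhere. The
embeddings turn neighbourhoods of latents into neighbourhoods of the signal. -/
theorem Linked.equivEverywhereVia {M M' : IVAEModel n k q d m}
    {A : Matrix (Fin n × Fin k) (Fin n × Fin k) ℝ} {c : Fin n × Fin k → ℝ}
    (h : M.Linked M' A c) (hf : Topology.IsEmbedding M.decoder)
    (hf' : Topology.IsEmbedding M'.decoder) (hM : M.RegularStats 0) (hM' : M'.RegularStats 0) :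
    M.EquivEverywhereVia M' A c := by
  intro p hp p' hp' e
  by_contra hne
  have h₁ : ContinuousAt (fun x : (Fin n → ℝ) × (Fin q → ℝ) => M.statVec x.1) p :=
    ContinuousAt.comp (hM.continuousAt_statVec hp.1) continuousAt_fst
  have h₂ : ContinuousAt (fun x : (Fin n → ℝ) × (Fin q → ℝ) => A *ᵥ M'.statVec x.1 + c) p' := by
    have h₃ : ContinuousAt (fun x : (Fin n → ℝ) × (Fin q → ℝ) => M'.statVec x.1) p' :=
      ContinuousAt.comp (hM'.continuousAt_statVec hp'.1) continuousAt_fst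
    have h₄ : Continuous fun v : Fin n × Fin k → ℝ => A *ᵥ v + c := by fun_prop
    exact h₄.continuousAt.comp h₃
  obtain ⟨O, O', hO, hO', hOO'⟩ := t2_separation_nhds hne
  have h₅ := h₁ hO
  have h₆ := h₂ hO'
  rw [Filter.mem_map, hf.nhds_eq_comap] at h₅
  rw [Filter.mem_map, hf'.nhds_eq_comap] at h₆
  obtain ⟨W, hW, hWO⟩ := h₅
  obtain ⟨W', hW', hWO'⟩ := h₆
  rw [← e] at hW'
  have hV : M.decoder ⁻¹' (W ∩ W') ∈ nhds p := hf.continuous.continuousAt (Filter.inter_mem hW hW')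
  have hpos := (Measure.mem_support_iff_forall _).1 (hM.mem_support_latentRef hp) _ hV
  refine hpos.ne' (measure_eq_zero_iff_ae_notMem.2 ?_)
  filter_upwards [h.exists_left] with x ⟨x', _, ex, hx⟩ hxV
  refine Set.disjoint_left.1 hOO' (hWO hxV.1) ?_
  change M.statVec x.1 ∈ O'
  rw [hx]
  exact hWO' (by rw [Set.mem_preimage, ex]; exact hxV.2)

/-! ### Tangents of the statistics and the block structure -/

/-- The derivative of a nontrivial linear combination of strongly exponential `C¹` statistics does
not vanish identically on the support. -/
theorem StronglyExponential.exists_sum_mul_deriv_ne_zero {M : IVAEModel n k q d m}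
    (hT : M.StronglyExponential) (hM : M.RegularStats 1) (i : Fin n) {r : Fin k → ℝ}
    (hr : r ≠ 0) : ∃ t, 0 < M.base i t ∧ ∑ j, r j * deriv (M.stat i j) t ≠ 0 := by
  by_contra! hcon
  obtain ⟨t₀, ht₀⟩ := nonempty_of_measure_ne_zero (M.volume_base_pos i).ne'
  obtain ⟨ε, hε, hball⟩ := Metric.isOpen_iff.1 (hM i).1 t₀ ht₀
  have hd : ∀ t, 0 < M.base i t →
      HasDerivAt (fun t => ∑ j, r j * M.stat i j t) (∑ j, r j * deriv (M.stat i j) t) t :=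
    fun t ht => HasDerivAt.fun_sum fun j _ =>
      ((((hM i).2 j).contDiffAt ((hM i).1.mem_nhds ht)).differentiableAt
        (by simp)).hasDerivAt.const_mul _
  have hconst := fun {t} ht => Metric.isOpen_ball.is_const_of_deriv_eq_zero
    (convex_ball t₀ ε).isPreconnected
    (fun t ht => (hd t (hball ht)).differentiableAt.differentiableWithinAt)
    (fun t ht => (hd t (hball ht)).deriv.trans (hcon t (hball ht))) (x := t) (y := t₀) ht
    (Metric.mem_ball_self hε)
  refine (Metric.measure_ball_pos volume t₀ hε).ne' (measure_mono_null ?_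
    (hT i r (∑ j, r j * M.stat i j t₀) hr))
  exact fun t ht => ⟨hball ht, hconst ht⟩

/-- The `(i, j)` coordinate of `A T(w)` is a sum over `i'` of functions of `w_{i'}`: these are the
summands. -/
noncomputable def blockStat (M : IVAEModel n k q d m) (A : Matrix (Fin n × Fin k) (Fin n × Fin k) ℝ)
    (i : Fin n) (j : Fin k) (i' : Fin n) (t : ℝ) : ℝ :=
  ∑ j', A (i, j) (i', j') * M.stat i' j' t

theorem mulVec_statVec_apply (M : IVAEModel n k q d m)
    (A : Matrix (Fin n × Fin k) (Fin n × Fin k) ℝ) (i : Fin n) (j : Fin k) (w : Fin n → ℝ) :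
    (A *ᵥ M.statVec w) (i, j) = ∑ i', M.blockStat A i j i' (w i') := by
  rw [Matrix.mulVec, dotProduct, Fintype.sum_prod_type]
  rfl

theorem RegularStats.contDiffAt_stat {M : IVAEModel n k q d m} (hM : M.RegularStats 1)
    {i : Fin n} (j : Fin k) {t : ℝ} (ht : 0 < M.base i t) : ContDiffAt ℝ 1 (M.stat i j) t := by
  simpa using ((hM i).2 j).contDiffAt ((hM i).1.mem_nhds ht)

theorem RegularStats.contDiffAt_blockStat {M : IVAEModel n k q d m} (hM : M.RegularStats 1)
    (A : Matrix (Fin n × Fin k) (Fin n × Fin k) ℝ) (i : Fin n) (j : Fin k) {i' : Fin n} {t : ℝ}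
    (ht : 0 < M.base i' t) : ContDiffAt ℝ 1 (M.blockStat A i j i') t :=
  ContDiffAt.sum fun j' _ => contDiffAt_const.mul (hM.contDiffAt_stat j' ht)

theorem RegularStats.deriv_blockStat {M : IVAEModel n k q d m} (hM : M.RegularStats 1)
    (A : Matrix (Fin n × Fin k) (Fin n × Fin k) ℝ) (i : Fin n) (j : Fin k) {i' : Fin n} {t : ℝ}
    (ht : 0 < M.base i' t) : deriv (M.blockStat A i j i') t =
      ∑ j', A (i, j) (i', j') * deriv (M.stat i' j') t :=
  (HasDerivAt.fun_sum fun j' _ => ((hM.contDiffAt_stat j' ht).differentiableAt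
    one_ne_zero).hasDerivAt.const_mul _).deriv

/-- Different summands of a block row of `A T'(w')` have parallel derivatives, since the block
row takes values in the curve `T_i`. -/
theorem Linked.deriv_blockStat_mul_eq {M M' : IVAEModel n k q d m}
    {A : Matrix (Fin n × Fin k) (Fin n × Fin k) ℝ} {c : Fin n × Fin k → ℝ}
    (h : M.Linked M' A c) (hf' : Function.Injective M'.decoder)
    (hM : M.RegularStats 1) (hM' : M'.RegularStats 1) (i : Fin n) {i' l' : Fin n} (hil : i' ≠ l')
    {a b : ℝ} (ha : 0 < M'.base i' a) (hb : 0 < M'.base l' b) (j₁ j₂ : Fin k) :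
    deriv (M'.blockStat A i j₁ i') a * deriv (M'.blockStat A i j₂ l') b =
      deriv (M'.blockStat A i j₂ i') a * deriv (M'.blockStat A i j₁ l') b := by
  classical
  have hrel : ∀ᵐ w, w ∈ M'.conceptSupport → ∃ t, 0 < M.base i t ∧
      ∀ j, M.stat i j t = (∑ l, M'.blockStat A i j l (w l)) + c (i, j) := by
    refine ae_latentRef_fst_iff.1 ?_
    filter_upwards [h.exists_right hf'] with p' ⟨p, hp, _, e⟩
    refine ⟨p.1 i, hp i, fun j => ?_⟩
    rw [← mulVec_statVec_apply]
    exact congrFun e (i, j)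
  -- A measurable null hull, since the existential relation is not known to be measurable.
  set S := toMeasurable volume {w | ¬ (w ∈ M'.conceptSupport → ∃ t, 0 < M.base i t ∧
      ∀ j, M.stat i j t = (∑ l, M'.blockStat A i j l (w l)) + c (i, j))} with hSdef
  have hS0 : ∀ᵐ w, w ∉ S := measure_eq_zero_iff_ae_notMem.1 (by
    rw [hSdef, measure_toMeasurable]; exact hrel)
  let φ : ℝ × ℝ → Fin n → ℝ := fun x => Pi.single i' x.1 + Pi.single l' x.2
  have hsingle : ∀ l, Continuous fun t : ℝ => (Pi.single l t : Fin n → ℝ) :=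
    fun l => continuous_single (A := fun _ => ℝ) l
  have hφc : Continuous φ :=
    ((hsingle i').comp continuous_fst).add ((hsingle l').comp continuous_snd)
  rw [ae_notMem_iff_ae_ae_add_notMem (ρ := (volume : Measure (ℝ × ℝ))) hφc.measurable
    (measurableSet_toMeasurable _ _)] at hS0
  -- A base point in the support such that the relation survives almost every change of the
  -- coordinates `i'` and `l'` that stays in the support.
  obtain ⟨w, hw, hwS⟩ : ∃ w ∈ M'.conceptSupport, ∀ᵐ x : ℝ × ℝ, w + φ x ∉ S := by
    by_contra! hcon
    refine M'.volume_conceptSupport_pos.ne' (measure_eq_zero_iff_ae_notMem.2 ?_)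
    filter_upwards [hS0] with w hw hw' using hcon w hw' hw
  have hi' : ∀ x, (w + φ x) i' = w i' + x.1 := fun x => by simp [φ, hil]
  have hl' : ∀ x, (w + φ x) l' = w l' + x.2 := fun x => by simp [φ, hil.symm]
  have ho : ∀ x l, l ≠ i' → l ≠ l' → (w + φ x) l = w l := fun x l h₁ h₂ => by simp [φ, h₁, h₂]
  let K : Fin k → ℝ := fun j =>
    (∑ l ∈ (Finset.univ.erase i').erase l', M'.blockStat A i j l (w l)) + c (i, j)
  have hsum : ∀ x j, (∑ l, M'.blockStat A i j l ((w + φ x) l)) + c (i, j) =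
      M'.blockStat A i j i' (w i' + x.1) + M'.blockStat A i j l' (w l' + x.2) + K j := by
    intro x j
    rw [← Finset.add_sum_erase _ _ (Finset.mem_univ i'),
      ← Finset.add_sum_erase _ _ (Finset.mem_erase.2 ⟨hil.symm, Finset.mem_univ l'⟩), hi', hl',
      Finset.sum_congr rfl fun l hl => by
        rw [ho x l (Finset.ne_of_mem_erase (Finset.mem_of_mem_erase hl))
          (Finset.ne_of_mem_erase hl)]]
    simp only [K]
    ring
  have hN := volume_image_plane_curve_eq_zero (U := {t | 0 < M.base i t})
    (g := fun t => M.stat i j₁ t - K j₁) (h := fun t => M.stat i j₂ t - K j₂)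
    (((by simpa using (hM i).2 j₁ : ContDiffOn ℝ 1 _ _)).sub contDiffOn_const)
    (((by simpa using (hM i).2 j₂ : ContDiffOn ℝ 1 _ _)).sub contDiffOn_const)
  have ea : w i' + (a - w i') = a := by ring
  have eb : w l' + (b - w l') = b := by ring
  have hV : {x : ℝ × ℝ | w + φ x ∈ M'.conceptSupport} ∈ nhds (a - w i', b - w l') := by
    refine (hM'.isOpen_conceptSupport.preimage (continuous_const.add hφc)).mem_nhds fun l => ?_
    change 0 < M'.base l ((w + φ (a - w i', b - w l')) l)
    by_cases h₁ : l = i'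
    · subst h₁; rw [hi']; simpa using ha
    by_cases h₂ : l = l'
    · subst h₂; rw [hl']; simpa using hb
    rw [ho _ l h₁ h₂]; exact hw l
  have hdiff : ∀ j l t, 0 < M'.base l t →
      ContDiffAt ℝ 1 (fun x => M'.blockStat A i j l (w l + x)) (t - w l) := by
    intro j l t ht
    refine ContDiffAt.comp (g := M'.blockStat A i j l) _ ?_ (contDiffAt_const.add contDiffAt_id)
    simpa using hM'.contDiffAt_blockStat A i j ht
  have key := deriv_mul_deriv_eq_of_ae_add_mem_null (hdiff j₁ i' a ha) (hdiff j₂ i' a ha)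
    (hdiff j₁ l' b hb) (hdiff j₂ l' b hb) hN hV (by
      filter_upwards [hwS] with x hx hxV
      have hx' := Set.notMem_subset (subset_toMeasurable _ _) hx
      simp only [Set.mem_ofPred_eq, not_not] at hx'
      obtain ⟨t, ht, htj⟩ := hx' hxV
      refine ⟨t, ht, ?_⟩
      simp only [htj, hsum, add_sub_cancel_right])
  simpa only [deriv_comp_const_add, ea, eb] using key

theorem Linked.isBlockPermutation {M M' : IVAEModel n k q d m}
    {A : Matrix (Fin n × Fin k) (Fin n × Fin k) ℝ} {c : Fin n × Fin k → ℝ}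
    (h : M.Linked M' A c) (hf' : Function.Injective M'.decoder) (hT : M.StronglyExponential)
    (hk : 2 ≤ k) (hM : M.RegularStats 1) (hM' : M'.RegularStats 1) : IsBlockPermutation A := by
  classical
  have hT' := h.stronglyExponential hT
  have hA := (h.isUnit_det hT).ne_zero
  -- The tangents of block row `i` span `ℝ^k`: the rows of `A` are independent and `M'` is strongly
  -- exponential.
  have hrow : ∀ (i : Fin n) (v : Fin k → ℝ), (∀ i' t, 0 < M'.base i' t →
      ∑ j, v j * deriv (M'.blockStat A i j i') t = 0) → v = 0 := by
    intro i v hv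
    let u : Fin n × Fin k → ℝ := fun a => if a.1 = i then v a.2 else 0
    have huA : ∀ a, (u ᵥ* A) a = ∑ j, v j * A (i, j) a := by
      intro a
      rw [Matrix.vecMul, dotProduct, Fintype.sum_prod_type, Finset.sum_eq_single i]
      · simp [u]
      · intro i' _ hi'; simp [u, hi']
      · simp
    have hu : u = 0 := by
      by_contra hu
      refine hA (Matrix.exists_vecMul_eq_zero_iff.1 ⟨u, hu, ?_⟩)
      suffices ∀ i', (fun j' => ∑ j, v j * A (i, j) (i', j')) = 0 from
        funext fun ⟨i', j'⟩ => (huA _).trans (congrFun (this i') j')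
      intro i'
      by_contra hr
      obtain ⟨t, ht, hne⟩ := hT'.exists_sum_mul_deriv_ne_zero hM' i' hr
      refine hne ?_
      rw [← hv i' t ht]
      simp only [hM'.deriv_blockStat A i _ ht, Finset.mul_sum, Finset.sum_mul]
      rw [Finset.sum_comm]
      simp only [mul_assoc]
    exact funext fun j => by simpa [u] using congrFun hu (i, j)
  have hblock : ∀ i i' j j', A (i, j) (i', j') ≠ 0 →
      ∃ t, 0 < M'.base i' t ∧ deriv (M'.blockStat A i j i') t ≠ 0 := by
    intro i i' j j' hne
    obtain ⟨t, ht, htne⟩ := hT'.exists_sum_mul_deriv_ne_zero hM' i'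
      (r := fun j' => A (i, j) (i', j')) (fun h0 => hne (congrFun h0 j'))
    exact ⟨t, ht, by rwa [hM'.deriv_blockStat A i j ht]⟩
  have huniq : ∀ i i' l' j₁ j₁' j₂ j₂', A (i, j₁) (i', j₁') ≠ 0 → A (i, j₂) (l', j₂') ≠ 0 →
      i' = l' := by
    intro i i' l' j₁ j₁' j₂ j₂' h₁ h₂
    by_contra hil
    obtain ⟨a, ha, hane⟩ := hblock i i' j₁ j₁' h₁
    obtain ⟨b, hb, hbne⟩ := hblock i l' j₂ j₂' h₂
    have hpar := fun {i' l' : Fin n} (hil : i' ≠ l') {a b : ℝ} (ha : 0 < M'.base i' a)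
      (hb : 0 < M'.base l' b) (j₁ j₂ : Fin k) =>
      h.deriv_blockStat_mul_eq hf' hM hM' i hil ha hb j₁ j₂
    have hbne' : deriv (M'.blockStat A i j₁ l') b ≠ 0 := by
      intro h0
      have := hpar hil ha hb j₁ j₂
      rw [h0, mul_zero] at this
      exact (mul_ne_zero hane hbne) this
    -- Every tangent is parallel to the one of block `i'` at `a`. Within block `i'` itself, the
    -- comparison goes through the tangent of block `l'` at `b`, whose `j₁` entry is nonzero.
    have hall : ∀ l t, 0 < M'.base l t → ∀ j,
        deriv (M'.blockStat A i j₁ i') a * deriv (M'.blockStat A i j l) t =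
          deriv (M'.blockStat A i j i') a * deriv (M'.blockStat A i j₁ l) t := by
      intro l t ht j
      by_cases hl : l = i'
      · subst hl
        have e₁ := hpar hil ht hb j₁ j
        have e₂ := hpar hil ha hb j₁ j
        refine mul_right_cancel₀ hbne' ?_
        linear_combination
          (-deriv (M'.blockStat A i j₁ l) a) * e₁ + deriv (M'.blockStat A i j₁ l) t * e₂
      · exact hpar (Ne.symm hl) ha ht j₁ j
    have : Nontrivial (Fin k) := Fin.nontrivial_iff_two_le.2 hk
    obtain ⟨j₃, hj₃⟩ := exists_ne j₁
    -- A vector orthogonal to the common tangent direction; a second index `j₃` exists because `k ≥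
    -- 2`.
    have hz := hrow i (Pi.single j₃ (deriv (M'.blockStat A i j₁ i') a) -
      Pi.single j₁ (deriv (M'.blockStat A i j₃ i') a)) (by
        intro l t ht
        simp only [Pi.sub_apply, sub_mul, Finset.sum_sub_distrib]
        rw [Finset.sum_eq_single j₃ (fun j _ hj => by simp [hj]) (by simp),
          Finset.sum_eq_single j₁ (fun j _ hj => by simp [hj]) (by simp)]
        simp only [Pi.single_eq_same]
        rw [hall l t ht j₃, sub_self])
    have := congrFun hz j₃
    simp only [Pi.sub_apply, Pi.single_eq_same, Pi.single_eq_of_ne hj₃, sub_zero,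
      Pi.zero_apply] at this
    exact hane this
  have hex : ∀ i, ∃ i' j j', A (i, j) (i', j') ≠ 0 := by
    intro i
    by_contra! hcon
    exact hA (Matrix.det_eq_zero_of_row_eq_zero (i, ⟨0, by omega⟩) fun a => hcon a.1 _ a.2)
  choose s j j' hs using hex
  -- An index missed by `s` would give a zero column of `A`; on a finite set, surjective means
  -- bijective.
  have hsurj : Function.Surjective s := by
    intro i'
    by_contra! hcon
    refine hA (Matrix.det_eq_zero_of_column_eq_zero (i', ⟨0, by omega⟩) fun a => ?_)
    by_contra hne
    exact hcon a.1 (huniq a.1 _ _ _ _ _ _ (hs a.1) hne)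
  refine ⟨Equiv.ofBijective s (Finite.surjective_iff_bijective.1 hsurj), fun i i' l l' hi' => ?_⟩
  by_contra hne
  exact hi' (huniq i _ _ _ _ _ _ hne (hs i))

end IVAEModel

theorem theorem1 {n k q d m : ℕ}
    (ν : Measure (EuclideanSpace ℝ (Fin d))) [IsProbabilityMeasure ν]
    (hν : ∀ᵐ t ∂(volume : Measure (EuclideanSpace ℝ (Fin d))), charFun ν t ≠ 0)
    (M M' : IVAEModel n k q d m)
    (hf : Function.Injective M.decoder) (hf' : Function.Injective M'.decoder)
    (hT : M.StronglyExponential) (hL : M.Variability)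
    (hobs : M.obsLaw ν = M'.obsLaw ν) :
    ∃ (A : Matrix (Fin n × Fin k) (Fin n × Fin k) ℝ) (c : Fin n × Fin k → ℝ),
      IsUnit A.det ∧ M.EquivVia M' A c ∧
      (Topology.IsEmbedding M.decoder → Topology.IsEmbedding M'.decoder →
        M.RegularStats 0 → M'.RegularStats 0 → M.EquivEverywhereVia M' A c) ∧
      (2 ≤ k → M.RegularStats 1 → M'.RegularStats 1 → IsBlockPermutation A) := by
  have hJ := IVAEModel.jointLaw_eq_of_obsLaw_eq hν hobs
  obtain ⟨A, c, h⟩ := IVAEModel.exists_linked hf hf' hL hJ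
  exact ⟨A, c, h.isUnit_det hT, h.equivVia hf hJ, h.equivEverywhereVia,
    h.isBlockPermutation hf' hT⟩
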